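/- Let $\mathfrak C$ be a monster model of a first-order theory in a language $L$, i.e. $\mathfrak C$ is $\kappa$-saturated and strongly $\kappa$-homogeneous for some uncountable strong limit cardinal $\kappa>|L|$; "small" and "bounded" mean "of cardinality $<\kappa$". Let $A\subseteq\mathfrak C$ be small and let $H\subseteq\mathfrak C^m$ be a group definable over $A$ (its underlying set and its multiplication are definable with parameters from $A$). Assume: - $H$ is absolutely connected: $H$ has no proper type-definable (over a small set) subgroup of bounded index; - $H$ has fsg: there are a complete type $q$ over $\mathfrak C$ containing the formula defining $H$ and a small model $M\prec\mathfrak C$ such that for every $g\in H$ the translate $gq$ is finitely satisfiable in $M$. Call a complete type over $\mathfrak C$ containing the formula defining $H$ generic if for every formula $\varphi$ in it, finitely many left translates of $\varphi(\mathfrak C)\cap H$ cover $H$. Then $H$ has exactly one global generic type $p$, this $p$ is invariant over $A$, and for every integer $n\ge 1$ each element of $\Gamma_n(H)$ is a (finite) product of conjugates in $H$ of elements of the set $$\{\gamma_n(g_0,\dots,g_{n-1}) : (g_0,\dots,g_{n-1})\models p^{(n)}|A\}.$$ Here $[x,y]=x^{-1}y^{-1}xy$; $\gamma_1(h_0)=h_0$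 and $\gamma_{n+1}(h_0,\dots,h_n)=[\gamma_n(h_0,\dots,h_{n-1}),h_n]$; $\Gamma_1(H)=H$ and $\Gamma_{n+1}(H)=[\Gamma_n(H),H]$ is the lower central series; a Morley sequence in $p$ over a small $C\supseteq A$ is a sequence $(a_i)$ such that $a_i\models p|C a_{<i}$ for all $i$; and $p^{(n)}$ is the complete type over $\mathfrak C$ whose restriction to each small $C\supseteq A$ is the (unique) type over $C$ of a Morley sequence in $p$ over $C$ of length $n$. -/

import Mathlib

open FirstOrder FirstOrder.Language Cardinal

universe u v w

namespace MonsterGroup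

section Basic

variable {L : FirstOrder.Language.{u, v}} {M : Type w} [L.Structure M]

/-- Two tuples of `M` have the same type over `A`. -/
def SameTypeOver (L : FirstOrder.Language.{u, v}) {M : Type w} [L.Structure M] {k : ℕ} (A : Set M)
    (c c' : Fin k → M) : Prop :=
  ∀ ψ : L[[A]].Formula (Fin k), ψ.Realize c ↔ ψ.Realize c'

/-- `M` is `κ`-saturated: a set of formulas in finitely many variables, over fewer than `κ`
parameters, which is finitely satisfiable in `M`, is realized in `M`. -/
def IsSaturated (L : FirstOrder.Language.{u, v}) (M : Type w) [L.Structure M]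
    (κ : Cardinal.{w}) : Prop :=
  ∀ (B : Set M), #B < κ → ∀ (k : ℕ) (S : Set (L[[B]].Formula (Fin k))),
    (∀ F : Finset (L[[B]].Formula (Fin k)), (F : Set (L[[B]].Formula (Fin k))) ⊆ S →
      ∃ a : Fin k → M, ∀ φ ∈ F, φ.Realize a) →
    ∃ a : Fin k → M, ∀ φ ∈ S, φ.Realize a

/-- `M` is strongly `κ`-homogeneous: a partial elementary map of `M` whose domain has fewer than
`κ` elements extends to an automorphism of `M`. -/
def IsStronglyHomogeneous (L : FirstOrder.Language.{u, v}) (M : Type w) [L.Structure M]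
    (κ : Cardinal.{w}) : Prop :=
  ∀ (B : Set M), #B < κ → ∀ f : B → M,
    (∀ φ : L.Formula B, φ.Realize (fun b : B => (b : M)) ↔ φ.Realize f) →
    ∃ σ : M ≃[L] M, ∀ b : B, σ b = f b

/-- `M` is a monster model with degree of saturation `κ`, where `κ` is an uncountable strong limit
cardinal larger than the cardinality of the language.  "Small" and "bounded" mean
"of cardinality less than `κ`". -/
structure IsMonster (L : FirstOrder.Language.{u, v}) (M : Type w) [L.Structure M]
    (κ : Cardinal.{w}) : Prop where
  aleph0_lt : ℵ₀ < κ
  strongLimit : κ.IsStrongLimit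
  card_lt : Cardinal.lift.{w} L.card < Cardinal.lift.{max u v} κ
  saturated : IsSaturated L M κ
  homogeneous : IsStronglyHomogeneous L M κ

/-- Complete types over the whole of `M`, in the variables `α`. -/
abbrev GlobalType (L : FirstOrder.Language.{u, v}) (M : Type w) [L.Structure M] (α : Type) :=
  (L[[M]].completeTheory M).CompleteType α

/-- The set of formulas, with parameters from `M`, which belong to a global type. -/
def GlobalType.formulas {α : Type} (p : GlobalType L M α) : Set (L[[M]].Formula α) :=
  {φ | Formula.equivSentence φ ∈ p}

/-- The set `X` is defined by a formula that belongs to `p`. -/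
def GlobalType.Contains {α : Type} (p : GlobalType L M α) (X : Set (α → M)) : Prop :=
  ∃ φ ∈ p.formulas, {x : α → M | φ.Realize x} = X

/-- `a` realizes the restriction to `B` of a set `S` of formulas with parameters from `M`. -/
def RealizesOver {α : Type} (S : Set (L[[M]].Formula α)) (B : Set M) (a : α → M) : Prop :=
  ∀ φ : L[[B]].Formula α,
    (L.lhomWithConstantsMap (fun b : B => (b : M))).onFormula φ ∈ S → φ.Realize a

/-- The set `S` of formulas is finitely satisfiable in the subset `N` of `M`. -/
def FinitelySatisfiableIn {α : Type} (S : Set (L[[M]].Formula α)) (N : Set M) : Prop :=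
  ∀ F : Finset (L[[M]].Formula α), (F : Set (L[[M]].Formula α)) ⊆ S →
    ∃ a : α → M, (∀ i, a i ∈ N) ∧ ∀ φ ∈ F, φ.Realize a

/-- `p` is invariant over `A`: whether `φ(x, c)` belongs to `p` depends only on `φ` and on the type
of `c` over `A`. -/
def GlobalType.IsInvariantOver {α : Type} (p : GlobalType L M α) (A : Set M) : Prop :=
  ∀ (k : ℕ) (φ : L.Formula (α ⊕ Fin k)) (c c' : Fin k → M), SameTypeOver L A c c' →
    (p.Contains {x | φ.Realize (Sum.elim x c)} ↔ p.Contains {x | φ.Realize (Sum.elim x c')})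

/-- `(a 0, …, a (n - 1))` is a Morley sequence in `p` over `A`: each `a i` realizes the restriction
of `p` to `A` together with the coordinates of the `a j` with `j < i`. -/
def GlobalType.IsMorleySequence {m n : ℕ} (p : GlobalType L M (Fin m)) (A : Set M)
    (a : Fin n → Fin m → M) : Prop :=
  ∀ i, RealizesOver p.formulas (A ∪ {b | ∃ j < i, ∃ t, b = a j t}) (a i)

/-- The power `p^{(n)}` of a global type `p` invariant over the small set `A`, as a set of formulas
over `M`.  All Morley sequences in `p` of length `n` over a small set `C ⊇ A` have the same type
over `C`, and `p^{(n)}` is the complete type over `M` whose restriction to each such `C` is that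
type.  So a formula belongs to it if and only if it holds of the Morley sequences over `A ∪ B` as
soon as the finite set `B` is large enough (containing the parameters of the formula). -/
def GlobalType.power {m : ℕ} (p : GlobalType L M (Fin m)) (A : Set M) (n : ℕ) :
    Set (L[[M]].Formula (Fin n × Fin m)) :=
  {φ | ∃ B : Set M, B.Finite ∧ ∀ a : Fin n → Fin m → M,
    p.IsMorleySequence (A ∪ B) a → φ.Realize (fun t => a t.1 t.2)}

end Basic

section Group

variable (L : FirstOrder.Language.{u, v}) {M : Type w} [L.Structure M] {m : ℕ}
  (H : Set (Fin m → M)) [Group H]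

/-- The group `H` is definable over `A`: so are its underlying set and the graph of its
multiplication. -/
structure IsDefinableGroup (A : Set M) : Prop where
  carrier : A.Definable L H
  mul : A.Definable L {z : Fin 3 × Fin m → M | ∃ x y : H,
    (fun i => z (0, i)) = (x : Fin m → M) ∧ (fun i => z (1, i)) = (y : Fin m → M) ∧
      (fun i => z (2, i)) = ((x * y : H) : Fin m → M)}

/-- The subgroup `K` of `H` is type-definable: it is defined by a set of formulas over a small set
of parameters. -/
def IsTypeDefinable (κ : Cardinal.{w}) (K : Subgroup H) : Prop :=
  ∃ B : Set M, #B < κ ∧ ∃ S : Set (L[[B]].Formula (Fin m)),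
    ∀ x : Fin m → M, (∃ hx : x ∈ H, (⟨x, hx⟩ : H) ∈ K) ↔ ∀ φ ∈ S, φ.Realize x

/-- `H` has no proper type-definable subgroup of bounded index. -/
def IsAbsolutelyConnected (κ : Cardinal.{w}) : Prop :=
  ∀ K : Subgroup H, IsTypeDefinable L H κ K → #(H ⧸ K) < κ → K = ⊤

/-- The translate `g p` of a global type `p` containing `H`: the formula `φ(x)` belongs to `g p`
if and only if `φ(g * x)` belongs to `p`. -/
def translate (g : H) (p : GlobalType L M (Fin m)) : Set (L[[M]].Formula (Fin m)) :=
  {φ | p.Contains {x | ∃ hx : x ∈ H, φ.Realize ((g * ⟨x, hx⟩ : H) : Fin m → M)}}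

/-- `H` has finitely satisfiable generics: there are a global type `p` containing `H` and a small
elementary substructure `N` of `M` such that every translate of `p` is finitely satisfiable
in `N`. -/
def HasFSG (κ : Cardinal.{w}) : Prop :=
  ∃ p : GlobalType L M (Fin m), p.Contains H ∧
    ∃ N : L.ElementarySubstructure M, #N < κ ∧
      ∀ g : H, FinitelySatisfiableIn (translate L H g p) (N : Set M)

/-- Finitely many left translates of the trace of `X` on `H` cover `H`. -/
def IsLeftGeneric (X : Set (Fin m → M)) : Prop :=
  ∃ F : Finset H, ∀ h : H, ∃ f ∈ F, ∃ x : H, (x : Fin m → M) ∈ X ∧ h = f * x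

/-- `p` is a global generic type of `H`. -/
def IsGenericType (p : GlobalType L M (Fin m)) : Prop :=
  p.Contains H ∧ ∀ φ ∈ p.formulas, IsLeftGeneric H {x | φ.Realize x}

end Group

/-- The iterated commutator of `n + 1` elements, that is, `γ_{n+1}(g 0, …, g n)`, where
`γ_1(h) = h`, `γ_{n+1}(h_0, …, h_n) = [γ_n(h_0, …, h_{n-1}), h_n]` and
`[x, y] = x⁻¹ y⁻¹ x y`. -/
def iteratedCommutator {G : Type*} [Group G] : (n : ℕ) → (Fin (n + 1) → G) → G
  | 0, g => g 0
  | n + 1, g =>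
    (iteratedCommutator n fun i => g i.castSucc)⁻¹ * (g (Fin.last (n + 1)))⁻¹ *
      (iteratedCommutator n fun i => g i.castSucc) * g (Fin.last (n + 1))

end MonsterGroup

/-! If some left translate of a definable `X` lies in the fsg type, then every left translate of `X`
meets the small model `N`, hence, by saturation, a fixed finite subset of `N`. This property
characterizes genericity (`leftGen_iff_exists_finset`), so left and right genericity agree and the
non-generic definable sets form an ideal.

Modulo this ideal, the stabilizer of `X` has index at most `2 ^ #N`, since a coset is determined by
the trace of a translate of `X` on `N`. It is also type-definable, so absolute connectedness makes
it all of `H` (`stabilizer_eq_top`). Definable sets are thus translation invariant up to non-generic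
sets, and the fsg type `p` consists exactly of the generic sets (`mem_iff_leftGen`). Hence `p` is
the only generic type. Being covered by `k` translates is an `A`-definable condition and compactness
bounds `k`, so `p` is definable over `A` (`definable_contains`).

As right generic sets are left generic, `p` is preserved by `x ↦ x⁻¹ * a`, so every element is a
product of two realizations of `p` over any small set (`exists_mul_eq`). Either factor extends a
given Morley sequence. Writing `x^y = y⁻¹xy`, the identities `[x, ab] = [x, b] [x, a]^b` and `[xy,
h] = [x, h]^y [y, h]` then give the claim by induction along the lower central series. -/

namespace MonsterGroup

/-! ### Generic sets, the ideal of non-generic sets and stabilizers -/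

section GenericSets

variable {G : Type*} [Group G]

/-- Finitely many left translates of `X` cover the group. -/
def LeftGen (X : Set G) : Prop := ∃ F : Finset G, ∀ h, ∃ f ∈ F, f * h ∈ X

/-- Finitely many right translates of `X` cover the group. -/
def RightGen (X : Set G) : Prop := ∃ F : Finset G, ∀ h, ∃ f ∈ F, h * f ∈ X

theorem LeftGen.mono {X Y : Set G} (h : LeftGen X) (hXY : X ⊆ Y) : LeftGen Y := by
  obtain ⟨F, hF⟩ := h
  exact ⟨F, fun h => let ⟨f, hf, hx⟩ := hF h; ⟨f, hf, hXY hx⟩⟩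

theorem LeftGen.shift {X : Set G} (h : LeftGen X) (g : G) : LeftGen {x | g * x ∈ X} := by
  classical
  obtain ⟨F, hF⟩ := h
  refine ⟨F.image (g⁻¹ * ·), fun h => ?_⟩
  obtain ⟨f, hf, hx⟩ := hF h
  exact ⟨g⁻¹ * f, Finset.mem_image_of_mem _ hf, by simpa [mul_assoc] using hx⟩

theorem leftGen_shift_iff {X : Set G} (g : G) : LeftGen {x | g * x ∈ X} ↔ LeftGen X :=
  ⟨fun h => (h.shift g⁻¹).mono fun x hx => by simpa using hx, fun h => h.shift g⟩

theorem leftGen_inv_iff {X : Set G} : LeftGen {x | x⁻¹ ∈ X} ↔ RightGen X := by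
  classical
  constructor
  · rintro ⟨F, hF⟩
    refine ⟨F.image (·⁻¹), fun h => ?_⟩
    obtain ⟨f, hf, hx⟩ := hF h⁻¹
    exact ⟨f⁻¹, Finset.mem_image_of_mem _ hf, by simpa using hx⟩
  · rintro ⟨F, hF⟩
    refine ⟨F.image (·⁻¹), fun h => ?_⟩
    obtain ⟨f, hf, hx⟩ := hF h⁻¹
    exact ⟨f⁻¹, Finset.mem_image_of_mem _ hf, by simpa using hx⟩

theorem rightGen_inv_iff {X : Set G} : RightGen {x | x⁻¹ ∈ X} ↔ LeftGen X := by
  rw [← leftGen_inv_iff]; simp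

theorem LeftGen.nonempty {X : Set G} (h : LeftGen X) : X.Nonempty := by
  obtain ⟨F, hF⟩ := h
  obtain ⟨f, -, hx⟩ := hF 1
  exact ⟨_, hx⟩

/-- An ultrafilter `Q` on an algebra `D` of subsets of a group, closed under left translations and
inversion, all of whose translates concentrate on the set `N`. -/
structure IsFSGUltrafilter (D Q : Set G → Prop) (N : Set G) : Prop where
  compl : ∀ {X}, D X → D Xᶜ
  inter : ∀ {X Y}, D X → D Y → D (X ∩ Y)
  shift : ∀ {X}, D X → ∀ g, D {x | g * x ∈ X}
  inv : ∀ {X}, D X → D {x | x⁻¹ ∈ X}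
  mem_or : ∀ {X}, D X → Q X ∨ Q Xᶜ
  mem_inter : ∀ {X Y}, Q X → Q Y → Q (X ∩ Y)
  mem_nonempty : ∀ {X}, Q X → X.Nonempty
  mem_mono : ∀ {X Y}, Q X → D Y → X ⊆ Y → Q Y
  exists_mem : ∀ {X}, D X → ∀ g, Q {x | g * x ∈ X} → ∃ n ∈ N, n ∈ X
  compact : ∀ {X}, D X → (∀ h, ∃ n ∈ N, h * n ∈ X) →
    ∃ F : Finset G, (F : Set G) ⊆ N ∧ ∀ h, ∃ n ∈ F, h * n ∈ X

namespace IsFSGUltrafilter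

variable {D Q : Set G → Prop} {N : Set G} (hQ : IsFSGUltrafilter D Q N)
include hQ

theorem union {X Y : Set G} (hX : D X) (hY : D Y) : D (X ∪ Y) := by
  have := hQ.compl (hQ.inter (hQ.compl hX) (hQ.compl hY))
  rwa [Set.compl_inter, compl_compl, compl_compl] at this

theorem symmDiff {X Y : Set G} (hX : D X) (hY : D Y) : D (symmDiff X Y) :=
  hQ.union (hQ.inter hX (hQ.compl hY)) (hQ.inter hY (hQ.compl hX))

/-- Otherwise `Q` contains the complements of all translates, and the intersection of finitely many
of them is nonempty, so no finite family of translates covers. -/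
theorem exists_mem_of_leftGen {X : Set G} (hX : D X) (h : LeftGen X) :
    ∃ g, Q {x | g * x ∈ X} := by
  by_contra! hcon
  obtain ⟨F, hF⟩ := h
  have key : ∀ F : Finset G, ∃ Y, Q Y ∧ ∀ y ∈ Y, ∀ f ∈ F, f * y ∉ X := by
    intro F
    classical
    induction F using Finset.induction_on with
    | empty => exact (hQ.mem_or hX).elim (fun h => ⟨_, h, by simp⟩) (fun h => ⟨_, h, by simp⟩)
    | insert f F _ ih =>
      obtain ⟨Y, hY, hYF⟩ := ih
      refine ⟨_, hQ.mem_inter hY ((hQ.mem_or (hQ.shift hX f)).resolve_left (hcon f)), ?_⟩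
      rintro y ⟨hy, hyf⟩ f' hf'
      obtain rfl | hf' := Finset.mem_insert.1 hf'
      · exact hyf
      · exact hYF y hy f' hf'
  obtain ⟨Y, hY, hYF⟩ := key F
  obtain ⟨y, hy⟩ := hQ.mem_nonempty hY
  obtain ⟨f, hf, hx⟩ := hF y
  exact hYF y hy f hf hx

/-- All translates of `Q` concentrate on `N`, so one translate of `X` in `Q` forces every translate
to meet `N`; `compact` makes this uniform. -/
theorem exists_finset_of_mem {X : Set G} (hX : D X) {g : G} (h : Q {x | g * x ∈ X}) :
    ∃ F : Finset G, (F : Set G) ⊆ N ∧ ∀ h, ∃ n ∈ F, h * n ∈ X := by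
  refine hQ.compact hX fun a => hQ.exists_mem (X := {x | a * x ∈ X}) (hQ.shift hX a) (a⁻¹ * g) ?_
  simpa [mul_assoc] using h

theorem rightGen_of_leftGen {X : Set G} (hX : D X) (h : LeftGen X) : RightGen X := by
  obtain ⟨g, hg⟩ := hQ.exists_mem_of_leftGen hX h
  obtain ⟨F, -, hF⟩ := hQ.exists_finset_of_mem hX hg
  exact ⟨F, hF⟩

theorem leftGen_iff_rightGen {X : Set G} (hX : D X) : LeftGen X ↔ RightGen X :=
  ⟨hQ.rightGen_of_leftGen hX, fun h => rightGen_inv_iff.1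
    (hQ.rightGen_of_leftGen (hQ.inv hX) (leftGen_inv_iff.2 h))⟩

/-- A set of the algebra is generic if and only if each of its left translates meets a fixed
finite subset of `N`. -/
theorem leftGen_iff_exists_finset {X : Set G} (hX : D X) :
    LeftGen X ↔ ∃ F : Finset G, (F : Set G) ⊆ N ∧ ∀ h, ∃ n ∈ F, h * n ∈ X := by
  refine ⟨fun h => ?_, fun ⟨F, _, hF⟩ => (hQ.leftGen_iff_rightGen hX).2 ⟨F, hF⟩⟩
  obtain ⟨g, hg⟩ := hQ.exists_mem_of_leftGen hX h
  exact hQ.exists_finset_of_mem hX hg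

theorem leftGen_of_mem {X : Set G} (hX : D X) (h : Q X) : LeftGen X :=
  (hQ.leftGen_iff_exists_finset hX).2 (hQ.exists_finset_of_mem hX (g := 1) (by simpa using h))

/-- A translate of the union lies in `Q`, hence so does the translate of one of the two sets, and
members of `Q` are generic. -/
theorem leftGen_union {X Y : Set G} (hX : D X) (hY : D Y) (h : LeftGen (X ∪ Y)) :
    LeftGen X ∨ LeftGen Y := by
  obtain ⟨g, hg⟩ := hQ.exists_mem_of_leftGen (hQ.union hX hY) h
  rcases hQ.mem_or (hQ.shift hX g) with h1 | h1
  · exact .inl ((leftGen_shift_iff g).1 (hQ.leftGen_of_mem (hQ.shift hX g) h1))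
  · refine .inr ((leftGen_shift_iff g).1 (hQ.leftGen_of_mem (hQ.shift hY g) ?_))
    exact hQ.mem_mono (hQ.mem_inter hg h1) (hQ.shift hY g) fun x hx => hx.1.resolve_left hx.2

theorem leftGen_symmDiff_trans {X Y Z : Set G} (hX : D X) (hY : D Y) (hZ : D Z)
    (h : LeftGen (_root_.symmDiff X Z)) :
    LeftGen (_root_.symmDiff X Y) ∨ LeftGen (_root_.symmDiff Y Z) :=
  hQ.leftGen_union (hQ.symmDiff hX hY) (hQ.symmDiff hY hZ)
    (h.mono (symmDiff_triangle X Y Z))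

/-- The stabilizer of a set of the algebra modulo the ideal of non-generic sets. -/
def stabilizer {X : Set G} (hX : D X) : Subgroup G where
  carrier := {g | ¬ LeftGen (_root_.symmDiff X {x | g * x ∈ X})}
  one_mem' h := by simpa using h.nonempty
  mul_mem' {a b} ha hb h := by
    rcases hQ.leftGen_symmDiff_trans hX (hQ.shift hX b) (hQ.shift hX (a * b)) h with h | h
    · exact hb h
    · refine ha ((leftGen_shift_iff b).1 (h.mono ?_))
      intro x hx
      simpa [Set.mem_symmDiff, mul_assoc] using hx
  inv_mem' {a} ha h := by
    refine ha ((leftGen_shift_iff a⁻¹).1 (h.mono ?_))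
    intro x hx
    simpa [Set.mem_symmDiff, or_comm] using hx

theorem mem_stabilizer_iff {X : Set G} (hX : D X) {g : G} :
    g ∈ hQ.stabilizer hX ↔ ¬ LeftGen (_root_.symmDiff X {x | g * x ∈ X}) := Iff.rfl

/-- Two translates of `X` with the same trace on `N` have a symmetric difference missing `N`, and a
generic set of the algebra meets `N`. -/
theorem mk_quotient_stabilizer_le {X : Set G} (hX : D X) :
    #(G ⧸ hQ.stabilizer hX) ≤ 2 ^ #N := by
  rw [← Cardinal.mk_set]
  let f : G ⧸ hQ.stabilizer hX → Set N := fun a => {n | (Quotient.out a)⁻¹ * (n : G) ∈ X}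
  refine Cardinal.mk_le_of_injective (f := f) fun a b hab => ?_
  rw [← Quotient.out_eq a, ← Quotient.out_eq b]
  refine QuotientGroup.eq.2 ((hQ.mem_stabilizer_iff hX).2 fun h => ?_)
  have hD := hQ.symmDiff (hQ.shift hX b.out⁻¹) (hQ.shift hX a.out⁻¹)
  have h' : LeftGen (_root_.symmDiff {x | b.out⁻¹ * x ∈ X} {x | a.out⁻¹ * x ∈ X}) := by
    refine (leftGen_shift_iff b.out).1 (h.mono fun x hx => ?_)
    simpa [Set.mem_symmDiff, mul_assoc] using hx
  obtain ⟨F, hF, hF'⟩ := (hQ.leftGen_iff_exists_finset hD).1 h'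
  obtain ⟨n, hn, hx⟩ := hF' 1
  have := congrArg (fun S => (⟨n, hF hn⟩ : N) ∈ S) hab
  simp only [f, Set.mem_ofPred_eq, eq_iff_iff] at this
  simp only [one_mul, Set.mem_symmDiff, Set.mem_ofPred_eq] at hx
  tauto

/-- If all stabilizers are trivial, then the ultrafilter consists of the generic sets. -/
theorem mem_iff_leftGen (hst : ∀ {X} (hX : D X), hQ.stabilizer hX = ⊤) {X : Set G} (hX : D X) :
    Q X ↔ LeftGen X := by
  refine ⟨hQ.leftGen_of_mem hX, fun h => (hQ.mem_or hX).resolve_right fun hc => ?_⟩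
  -- If `Xᶜ` and a translate of `X` are both in `Q`, so is the symmetric difference of `X` and that
  -- translate; it is then generic, against `g` being in the stabilizer.
  obtain ⟨g, hg⟩ := hQ.exists_mem_of_leftGen hX h
  have hD := hQ.symmDiff hX (hQ.shift hX g)
  refine (hQ.mem_stabilizer_iff hX (g := g)).1 (by rw [hst hX]; trivial) (hQ.leftGen_of_mem hD ?_)
  exact hQ.mem_mono (hQ.mem_inter hg hc) hD fun x hx => .inr hx

end IsFSGUltrafilter

theorem RightGen.leftGen_inv_mul {X : Set G} (h : RightGen X) (a : G) :
    LeftGen {x | x⁻¹ * a ∈ X} := by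
  classical
  obtain ⟨F, hF⟩ := h
  refine ⟨F.image (a * ·⁻¹), fun x => ?_⟩
  obtain ⟨f, hf, hx⟩ := hF x⁻¹
  exact ⟨a * f⁻¹, Finset.mem_image_of_mem _ hf, by simpa [mul_assoc] using hx⟩

end GenericSets

/-! ### Commutator identities and the lower central series -/

section Commutators

variable {G : Type*} [Group G]

/-- Let `S n` be sets of `(n + 1)`-tuples such that every element is a product of two elements by
which a given tuple of `S n` may be extended to `S (n + 1)`.  Then every element of the lower
central series is a product of conjugates of iterated commutators of tuples in these sets. -/
theorem mem_closure_conj_iteratedCommutator (S : (n : ℕ) → Set (Fin (n + 1) → G))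
    (h0 : ∀ x : G, ∃ a b, a * b = x ∧ (fun _ => a) ∈ S 0 ∧ (fun _ => b) ∈ S 0)
    (hS : ∀ n, ∀ g ∈ S n, ∀ x : G, ∃ a b, a * b = x ∧
      (Fin.snoc g a : Fin (n + 1 + 1) → G) ∈ S (n + 1) ∧
      (Fin.snoc g b : Fin (n + 1 + 1) → G) ∈ S (n + 1)) (n : ℕ) :
    ∀ x ∈ (⊤ : Subgroup G).lowerCentralSeries n,
      x ∈ Submonoid.closure {y | ∃ c, ∃ g ∈ S n, y = c⁻¹ * iteratedCommutator n g * c} := by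
  have hconj : ∀ n (c : G), ∀ x ∈ Submonoid.closure
      {y : G | ∃ c, ∃ g ∈ S n, y = c⁻¹ * iteratedCommutator n g * c}, c⁻¹ * x * c ∈
        Submonoid.closure {y | ∃ c, ∃ g ∈ S n, y = c⁻¹ * iteratedCommutator n g * c} := by
    intro n c x hx
    induction hx using Submonoid.closure_induction with
    | mem x hx =>
      obtain ⟨d, g, hg, rfl⟩ := hx
      exact Submonoid.subset_closure ⟨d * c, g, hg, by group⟩
    | one => simp
    | mul x y _ _ ihx ihy =>
      have := mul_mem ihx ihy
      rwa [show c⁻¹ * x * c * (c⁻¹ * y * c) = c⁻¹ * (x * y) * c by group] at this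
  induction n with
  | zero =>
    intro x _
    obtain ⟨a, b, rfl, ha, hb⟩ := h0 x
    exact mul_mem (Submonoid.subset_closure ⟨1, _, ha, by simp [iteratedCommutator]⟩)
      (Submonoid.subset_closure ⟨1, _, hb, by simp [iteratedCommutator]⟩)
  | succ n ih =>
    set T := Submonoid.closure
      {y : G | ∃ c, ∃ g ∈ S (n + 1), y = c⁻¹ * iteratedCommutator (n + 1) g * c} with hT
    have hsnoc : ∀ g ∈ S n, ∀ a : G, (Fin.snoc g a : Fin (n + 1 + 1) → G) ∈ S (n + 1) →
        (iteratedCommutator n g)⁻¹ * a⁻¹ * iteratedCommutator n g * a ∈ T := by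
      intro g _ a ha
      refine Submonoid.subset_closure ⟨1, _, ha, ?_⟩
      simp [iteratedCommutator]
    have hcomm : ∀ x ∈ Submonoid.closure
        {y : G | ∃ c, ∃ g ∈ S n, y = c⁻¹ * iteratedCommutator n g * c}, ∀ h : G,
        x⁻¹ * h⁻¹ * x * h ∈ T := by
      intro x hx
      induction hx using Submonoid.closure_induction with
      | mem x hx =>
        obtain ⟨c, g, hg, rfl⟩ := hx
        intro h
        -- Up to conjugation by `c`, this is the commutator of `γ(g)` with `c * h * c⁻¹ = a * b`,
        -- expanded by `[x, ab] = [x, b] [x, a]^b`.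
        obtain ⟨a, b, hab, ha, hb⟩ := hS n g hg (c * h * c⁻¹)
        have h1 := hconj (n + 1) c _ (mul_mem (hsnoc g hg b hb)
          (hconj (n + 1) b _ (hsnoc g hg a ha)))
        convert h1 using 1
        obtain rfl : h = c⁻¹ * (a * b) * c := by rw [hab]; group
        group
      | one => simp
      | mul x y _ _ ihx ihy =>
        intro h
        have := mul_mem (hconj (n + 1) y _ (ihx h)) (ihy h)
        convert this using 1
        group
    intro x hx
    rw [Subgroup.mem_lowerCentralSeries_succ_iff] at hx
    -- Here `⁅a, b⁆ = a * b * a⁻¹ * b⁻¹` is `[a⁻¹, b⁻¹]` in the other convention, and its inverse is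
    -- a conjugate of `[a, b⁻¹]`; thus products without inverses suffice.
    induction hx using Subgroup.closure_induction_left with
    | one => simp
    | mul_left x hx y _ ihy =>
      obtain ⟨a, ha, b, -, rfl⟩ := hx
      refine mul_mem ?_ ihy
      have := hcomm a⁻¹ (ih _ (inv_mem ha)) b⁻¹
      convert this using 1
      simp [commutatorElement_def]
    | inv_mul_cancel x hx y _ ihy =>
      obtain ⟨a, ha, b, -, rfl⟩ := hx
      refine mul_mem ?_ ihy
      have := hconj (n + 1) a⁻¹ _ (hcomm a (ih _ ha) b⁻¹)
      convert this using 1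
      simp [commutatorElement_def, mul_assoc]

end Commutators

/-! ### Global types as ultrafilters of definable sets -/

section Types

set_option linter.unusedSectionVars false

variable {L : FirstOrder.Language.{u, v}} {M : Type w} [L.Structure M]

instance lhomWithConstantsMap_val_isExpansionOn (B : Set M) :
    (L.lhomWithConstantsMap (fun b : B => (b : M))).IsExpansionOn M :=
  haveI : (LHom.constantsOnMap (fun b : B => (b : M))).IsExpansionOn M :=
    constantsOnMap_isExpansionOn rfl
  LHom.sumMap_isExpansionOn _ _ _

instance lhomWithConstantsMap_univ_isExpansionOn :
    (L.lhomWithConstantsMap (fun b : M => (⟨b, trivial⟩ : (Set.univ : Set M)))).IsExpansionOn M :=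
  haveI : (LHom.constantsOnMap
      (fun b : M => (⟨b, trivial⟩ : (Set.univ : Set M)))).IsExpansionOn M :=
    constantsOnMap_isExpansionOn rfl
  LHom.sumMap_isExpansionOn _ _ _

theorem definable_univ_iff {α : Type*} {X : Set (α → M)} :
    (Set.univ : Set M).Definable L X ↔ ∃ φ : L[[M]].Formula α, {x | φ.Realize x} = X := by
  constructor
  · rintro ⟨φ, rfl⟩
    exact ⟨(L.lhomWithConstantsMap (fun b : (Set.univ : Set M) => (b : M))).onFormula φ,
      by ext; simp [LHom.realize_onFormula]⟩
  · rintro ⟨φ, rfl⟩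
    exact ⟨(L.lhomWithConstantsMap
      (fun b : M => (⟨b, trivial⟩ : (Set.univ : Set M)))).onFormula φ,
      by ext; simp⟩

theorem IsSaturated.exists_mem_of_fip {α : Type*} [Finite α] {κ : Cardinal.{w}} (hM : IsSaturated L M κ) {B : Set M}
    (hB : #B < κ) (𝒳 : Set (Set (α → M))) (hdef : ∀ X ∈ 𝒳, B.Definable L X)
    (hfip : ∀ F : Finset (Set (α → M)), (F : Set (Set (α → M))) ⊆ 𝒳 → ∃ a, ∀ X ∈ F, a ∈ X) :
    ∃ a, ∀ X ∈ 𝒳, a ∈ X := by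
  classical
  obtain ⟨k, ⟨e⟩⟩ := Finite.exists_equiv_fin α
  obtain ⟨a, ha⟩ := hM B hB k {φ | {x : α → M | φ.Realize (x ∘ e.symm)} ∈ 𝒳} (by
    intro F hF
    obtain ⟨a, ha⟩ := hfip (F.image fun φ => {x : α → M | φ.Realize (x ∘ e.symm)}) (by
      intro X hX
      obtain ⟨φ, hφ, rfl⟩ := Finset.mem_image.1 hX
      exact hF hφ)
    exact ⟨a ∘ e.symm, fun φ hφ => ha _ (Finset.mem_image_of_mem _ hφ)⟩)
  refine ⟨a ∘ e, fun X hX => ?_⟩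
  obtain ⟨φ, rfl⟩ := hdef X hX
  have := ha (φ.relabel e) (by
    simpa [Formula.realize_relabel, Function.comp_assoc] using! hX)
  simpa [Formula.realize_relabel] using this

variable [Nonempty M] {α : Type} [Finite α] (p : GlobalType L M α)

namespace GlobalType

/-- Realizing `p` in a model `W` of the elementary diagram turns questions about membership in `p`
into truth at one point. -/
theorem exists_realization : ∃ (W : Theory.ModelType.{max u w, v, max u v w} (L[[M]].completeTheory M)) (v : α → W),
    ∀ φ : L[[M]].Formula α, φ ∈ p.formulas ↔ φ.Realize v := by
  obtain ⟨W, v, rfl⟩ := Theory.exists_modelType_is_realized_in _ p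
  exact ⟨W, v, fun φ =>
    Theory.CompleteType.formula_mem_typeOf (T := L[[M]].completeTheory M)⟩

theorem mem_formulas_mono {φ ψ : L[[M]].Formula α} (hφ : φ ∈ p.formulas)
    (h : ∀ x : α → M, φ.Realize x → ψ.Realize x) : ψ ∈ p.formulas := by
  obtain ⟨W, v, hv⟩ := p.exists_realization
  rw [hv] at hφ ⊢
  -- The inclusion of the two definable sets is a sentence true in `M`, hence in `W`.
  let χ : L[[M]].Sentence := Formula.iAlls α ((φ.imp ψ).relabel (Sum.inr : α → Empty ⊕ α))
  have hχ : χ ∈ L[[M]].completeTheory M := by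
    rw [mem_completeTheory]
    simp only [χ, Sentence.Realize, Formula.realize_iAlls, Formula.realize_relabel,
      Formula.realize_imp]
    exact fun i => h i
  have := Theory.realize_sentence_of_mem (M := W) _ hχ
  simp only [χ, Sentence.Realize, Formula.realize_iAlls, Formula.realize_relabel,
      Formula.realize_imp] at this
  exact this v hφ

theorem nonempty_of_mem_formulas {φ : L[[M]].Formula α} (hφ : φ ∈ p.formulas) :
    ∃ x : α → M, φ.Realize x := by
  by_contra! h
  have : (⊥ : L[[M]].Formula α) ∈ p.formulas := p.mem_formulas_mono hφ fun x hx => (h x hx).elim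
  obtain ⟨W, v, hv⟩ := p.exists_realization
  exact (hv _).1 this

theorem mem_formulas_iff_contains {φ : L[[M]].Formula α} :
    φ ∈ p.formulas ↔ p.Contains {x | φ.Realize x} := by
  refine ⟨fun h => ⟨φ, h, rfl⟩, fun ⟨ψ, hψ, h⟩ => p.mem_formulas_mono hψ fun x hx => ?_⟩
  exact h.subset hx

variable {p} {X Y : Set (α → M)}

theorem Contains.definable (h : p.Contains X) : (Set.univ : Set M).Definable L X := by
  obtain ⟨φ, -, rfl⟩ := h
  exact definable_univ_iff.2 ⟨φ, rfl⟩

theorem Contains.mono (h : p.Contains X) (hY : (Set.univ : Set M).Definable L Y) (hXY : X ⊆ Y) :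
    p.Contains Y := by
  obtain ⟨φ, hφ, rfl⟩ := h
  obtain ⟨ψ, rfl⟩ := definable_univ_iff.1 hY
  exact p.mem_formulas_iff_contains.1 (p.mem_formulas_mono hφ hXY)

theorem Contains.inter (hX : p.Contains X) (hY : p.Contains Y) : p.Contains (X ∩ Y) := by
  obtain ⟨φ, hφ, rfl⟩ := hX
  obtain ⟨ψ, hψ, rfl⟩ := hY
  refine ⟨φ ⊓ ψ, ?_, by ext; simp⟩
  obtain ⟨W, v, hv⟩ := p.exists_realization
  rw [hv] at *
  exact Formula.realize_inf.2 ⟨hφ, hψ⟩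

theorem contains_or_compl (p : GlobalType L M α)
    (hX : (Set.univ : Set M).Definable L X) : p.Contains X ∨ p.Contains Xᶜ := by
  obtain ⟨φ, rfl⟩ := definable_univ_iff.1 hX
  obtain ⟨W, v, hv⟩ := p.exists_realization
  by_cases h : φ.Realize v
  · exact .inl ⟨φ, (hv _).2 h, rfl⟩
  · exact .inr ⟨φ.not, (hv _).2 (Formula.realize_not.2 h), by ext; simp⟩

theorem Contains.nonempty (h : p.Contains X) : X.Nonempty := by
  obtain ⟨φ, hφ, rfl⟩ := h
  exact p.nonempty_of_mem_formulas hφ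

theorem ext_of_contains {p q : GlobalType L M α}
    (h : ∀ X, q.Contains X → p.Contains X) : q = p := by
  have hle : ∀ φ ∈ q.formulas, φ ∈ p.formulas := fun φ hφ =>
    p.mem_formulas_iff_contains.2 (h _ (q.mem_formulas_iff_contains.1 hφ))
  have key : ∀ s : L[[M]][[α]].Sentence, s ∈ q → s ∈ p := by
    intro s hs
    obtain ⟨φ, rfl⟩ := Formula.equivSentence.surjective s
    exact hle φ hs
  refine SetLike.ext fun s => ⟨key s, fun hs => ?_⟩
  by_contra hs'
  exact (p.not_mem_iff s).1 (key _ ((q.not_mem_iff s).2 hs')) hs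

theorem realizesOver_iff {B : Set M} {a : α → M} :
    RealizesOver p.formulas B a ↔ ∀ X, B.Definable L X → p.Contains X → a ∈ X := by
  constructor
  · rintro h X ⟨φ, rfl⟩ hX
    refine h φ (p.mem_formulas_iff_contains.2 ?_)
    simpa [LHom.realize_onFormula] using hX
  · intro h φ hφ
    refine h {x | φ.Realize x} ⟨φ, rfl⟩ ?_
    simpa [LHom.realize_onFormula] using p.mem_formulas_iff_contains.1 hφ

theorem _root_.MonsterGroup.RealizesOver.mem_iff {B : Set M} {a : α → M}
    (h : RealizesOver p.formulas B a) (hX : B.Definable L X) : a ∈ X ↔ p.Contains X := by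
  refine ⟨fun ha => ?_, realizesOver_iff.1 h X hX⟩
  refine (p.contains_or_compl (hX.mono (Set.subset_univ _))).resolve_right fun hc => ?_
  exact realizesOver_iff.1 h _ hX.compl hc ha

end GlobalType

theorem IsSaturated.exists_realizesOver {κ : Cardinal.{w}} (hM : IsSaturated L M κ) {B : Set M}
    (hB : #B < κ) : ∃ a, RealizesOver p.formulas B a := by
  obtain ⟨a, ha⟩ := hM.exists_mem_of_fip hB {X | B.Definable L X ∧ p.Contains X}
    (fun X hX => hX.1) (by
      classical
      intro F hF
      suffices ∃ Y, p.Contains Y ∧ ∀ X ∈ F, Y ⊆ X by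
        obtain ⟨Y, hY, h⟩ := this
        obtain ⟨a, ha⟩ := hY.nonempty
        exact ⟨a, fun X hX => h X hX ha⟩
      induction F using Finset.induction_on with
      | empty =>
        rcases p.contains_or_compl (X := ∅) Set.definable_empty with h | h
        · exact ⟨_, h, by simp⟩
        · exact ⟨_, h, by simp⟩
      | insert X F _ ih =>
        rw [Finset.coe_insert, Set.insert_subset_iff] at hF
        obtain ⟨Y, hY, h⟩ := ih hF.2
        refine ⟨X ∩ Y, hF.1.2.inter hY, fun Z hZ => ?_⟩
        obtain rfl | hZ := Finset.mem_insert.1 hZ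
        · exact Set.inter_subset_left
        · exact Set.inter_subset_right.trans (h Z hZ))
  exact ⟨a, GlobalType.realizesOver_iff.2 fun X h1 h2 => ha X ⟨h1, h2⟩⟩

end Types

/-! ### Definability of translates, inversion and covering conditions -/

section Definability

variable {L : FirstOrder.Language.{u, v}} {M : Type w} [L.Structure M] {A B : Set M}

theorem definable_iff {γ : Type*} {P Q : (γ → M) → Prop} (hP : A.Definable L {v | P v})
    (hQ : A.Definable L {v | Q v}) : A.Definable L {v | P v ↔ Q v} := by
  convert! (hP.inter hQ).union (hP.compl.inter hQ.compl) using 1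
  ext v
  simp only [Set.mem_ofPred_eq, Set.mem_union, Set.mem_inter_iff, Set.mem_compl_iff]
  tauto

theorem definableMap_reindex {β γ : Type*} (e : β → γ) :
    A.DefinableMap L (fun (v : γ → M) j => v (e j)) := fun _ => Set.DefinableFun.proj L

theorem definableMap_const {β γ : Type*} {c : β → M} (hc : ∀ j, c j ∈ A) :
    A.DefinableMap L (fun _ : γ → M => c) := fun j => L.definableFun_const γ (hc j)

theorem definable_singleton {β : Type*} [Finite β] {c : β → M} (hc : ∀ j, c j ∈ A) :
    A.Definable L ({c} : Set (β → M)) := by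
  have : ({c} : Set (β → M)) = ⋂ j, {x | x j = c j} := by
    ext x; simp [funext_iff]
  rw [this]
  exact Set.definable_iInter_of_finite fun j =>
    (Set.DefinableFun.proj L).ofPred_eq_const (hc j)

/-- The fibers of a definable set are definable over the additional parameters. -/
theorem definable_fiber {β δ : Type*} [Finite β] [Finite δ] {X : Set (β ⊕ δ → M)}
    (hX : A.Definable L X) {c : δ → M} (hc : ∀ j, c j ∈ A) :
    A.Definable L {x : β → M | Sum.elim x c ∈ X} := by
  refine hX.preimage_map (F := fun x => Sum.elim x c) ?_
  rintro (j | j)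
  · exact Set.DefinableFun.proj L
  · exact L.definableFun_const _ (hc j)

theorem definable_image_val {m : ℕ} {H : Set (Fin m → M)} {X : Set H} {Y : Set (Fin m → M)} (hH : A.Definable L H)
    (hY : A.Definable L Y) (h : ∀ x : H, x ∈ X ↔ (x : Fin m → M) ∈ Y) :
    A.Definable L (Subtype.val '' X) := by
  convert! hH.inter hY using 1
  ext x
  constructor
  · rintro ⟨x, hx, rfl⟩
    exact ⟨x.2, (h x).1 hx⟩
  · rintro ⟨hx, hx'⟩
    exact ⟨⟨x, hx⟩, (h ⟨x, hx⟩).2 hx', rfl⟩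

variable {m : ℕ} (H : Set (Fin m → M)) [Group H]

open Classical in
/-- The multiplication of `H`, extended to all tuples. -/
noncomputable def mulTotal (x y : Fin m → M) : Fin m → M :=
  if h : x ∈ H ∧ y ∈ H then ((⟨x, h.1⟩ * ⟨y, h.2⟩ : H) : Fin m → M) else x

@[simp]
theorem mulTotal_coe (x y : H) : mulTotal H (x : Fin m → M) y = ((x * y : H) : Fin m → M) := by
  simp [mulTotal]

variable {H}

namespace IsDefinableGroup

theorem mono (hH : IsDefinableGroup L H A) (hAB : A ⊆ B) : IsDefinableGroup L H B :=
  ⟨hH.carrier.mono hAB, hH.mul.mono hAB⟩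

variable (hH : IsDefinableGroup L H A)
include hH

/-- The graph splits into the part over `H × H`, a projection of the graph of multiplication, and
the rest, where the default value is the first argument. -/
theorem definableFun_mulTotal (i : Fin m) : A.DefinableFun L
    (fun v : Fin m ⊕ Fin m → M => mulTotal H (fun j => v (.inl j)) (fun j => v (.inr j)) i) := by
  have h1 : A.Definable L {v : Option (Fin m ⊕ Fin m) ⊕ Fin m → M |
      (fun t : Fin 3 × Fin m => v ((![fun j => .inl (some (.inl j)), fun j => .inl (some (.inr j)),
        fun j => .inr j] : Fin 3 → Fin m → Option (Fin m ⊕ Fin m) ⊕ Fin m) t.1 t.2)) ∈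
        {z : Fin 3 × Fin m → M | ∃ x y : H,
          (fun i => z (0, i)) = (x : Fin m → M) ∧ (fun i => z (1, i)) = (y : Fin m → M) ∧
          (fun i => z (2, i)) = ((x * y : H) : Fin m → M)}} :=
    hH.mul.preimage_map (definableMap_reindex _)
  have h2 : A.Definable L {v : Option (Fin m ⊕ Fin m) ⊕ Fin m → M |
      v (.inr i) = v (.inl none)} :=
    (Set.DefinableFun.proj L).ofPred_eq (Set.DefinableFun.proj L)
  have h3 : A.Definable L {v : Option (Fin m ⊕ Fin m) → M |
      (fun j => v (some (.inl j))) ∈ H} := hH.carrier.preimage_map (definableMap_reindex _)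
  have h4 : A.Definable L {v : Option (Fin m ⊕ Fin m) → M |
      (fun j => v (some (.inr j))) ∈ H} := hH.carrier.preimage_map (definableMap_reindex _)
  have h5 : A.Definable L {v : Option (Fin m ⊕ Fin m) → M |
      v (some (.inl i)) = v none} :=
    (Set.DefinableFun.proj L).ofPred_eq (Set.DefinableFun.proj L)
  refine (congrArg (A.Definable L) ?_).mp
    ((h1.inter h2).exists_of_finite.union ((h3.inter h4).compl.inter h5))
  ext v
  simp only [Set.mem_union, Set.mem_inter_iff, Set.mem_compl_iff, Set.mem_ofPred_eq,
    Function.tupleGraph, Function.comp_apply]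
  simp only [Matrix.cons_val_zero, Matrix.cons_val_one, Matrix.cons_val, Sum.elim_inl,
    Sum.elim_inr]
  by_cases h : (fun j => v (some (.inl j))) ∈ H ∧ (fun j => v (some (.inr j))) ∈ H
  · have e : mulTotal H (fun j => v (some (.inl j))) (fun j => v (some (.inr j))) =
        ((⟨_, h.1⟩ * ⟨_, h.2⟩ : H) : Fin m → M) := mulTotal_coe H ⟨_, h.1⟩ ⟨_, h.2⟩
    rw [e]
    constructor
    · rintro (⟨u, ⟨x, y, hx, hy, hu⟩, hui⟩ | h')
      · obtain rfl : x = ⟨_, h.1⟩ := Subtype.ext hx.symm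
        obtain rfl : y = ⟨_, h.2⟩ := Subtype.ext hy.symm
        rw [← hui, ← hu]
      · exact (h'.1 h).elim
    · intro h'
      exact .inl ⟨_, ⟨⟨_, h.1⟩, ⟨_, h.2⟩, rfl, rfl, rfl⟩, h'⟩
  · have e : mulTotal H (fun j => v (some (.inl j))) (fun j => v (some (.inr j))) =
        (fun j => v (some (.inl j))) := dif_neg h
    rw [e]
    constructor
    · rintro (⟨u, ⟨x, y, hx, hy, -⟩, -⟩ | h')
      · exact (h ⟨hx ▸ x.2, hy ▸ y.2⟩).elim
      · exact h'.2
    · exact fun h' => .inr ⟨h, h'⟩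

theorem definableMap_mul {γ : Type*} {F G : (γ → M) → Fin m → M}
    (hF : A.DefinableMap L F) (hG : A.DefinableMap L G) :
    A.DefinableMap L (fun v => mulTotal H (F v) (G v)) := by
  intro i
  refine Set.DefinableFun.comp (g := fun v => Sum.elim (F v) (G v)) ?_
    (hH.definableFun_mulTotal i)
  rintro (j | j)
  · exact hF j
  · exact hG j

theorem definable_compl {X : Set H} (hX : A.Definable L (Subtype.val '' X)) :
    A.Definable L (Subtype.val '' Xᶜ) :=
  definable_image_val hH.carrier hX.compl fun x => by simp

theorem definable_mul_left {X : Set H} (hX : A.Definable L (Subtype.val '' X)) {g : H}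
    (hg : ∀ j, (g : Fin m → M) j ∈ A) : A.Definable L (Subtype.val '' {x : H | g * x ∈ X}) :=
  definable_image_val hH.carrier
    (hX.preimage_map (hH.definableMap_mul (definableMap_const hg) (definableMap_reindex id)))
    fun x => by simp

theorem definable_mul_right {X : Set H} (hX : A.Definable L (Subtype.val '' X)) {g : H}
    (hg : ∀ j, (g : Fin m → M) j ∈ A) : A.Definable L (Subtype.val '' {x : H | x * g ∈ X}) :=
  definable_image_val hH.carrier
    (hX.preimage_map (hH.definableMap_mul (definableMap_reindex id) (definableMap_const hg)))
    fun x => by simp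

/-- Inversion is avoided: `x⁻¹ * g` is the solution `y` of `x * y = g`. -/
theorem definable_inv_mul {X : Set H} (hX : A.Definable L (Subtype.val '' X)) {g : H}
    (hg : ∀ j, (g : Fin m → M) j ∈ A) : A.Definable L (Subtype.val '' {x : H | x⁻¹ * g ∈ X}) := by
  have h1 : A.Definable L {v : Fin m ⊕ Fin m → M | (fun j => v (.inr j)) ∈ Subtype.val '' X} :=
    hX.preimage_map (definableMap_reindex _)
  have h2 : A.Definable L {v : Fin m ⊕ Fin m → M |
      mulTotal H (fun j => v (.inl j)) (fun j => v (.inr j)) ∈ ({↑g} : Set (Fin m → M))} :=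
    (definable_singleton hg).preimage_map
      (hH.definableMap_mul (definableMap_reindex _) (definableMap_reindex _))
  refine definable_image_val hH.carrier (h1.inter h2).exists_of_finite fun x => ?_
  simp only [Set.mem_ofPred_eq, Set.mem_inter_iff, Sum.elim_inl, Sum.elim_inr,
    Set.mem_singleton_iff]
  constructor
  · intro hx
    exact ⟨_, ⟨_, hx, rfl⟩, by simp⟩
  · rintro ⟨u, ⟨y, hy, hu⟩, h⟩
    obtain rfl : (y : Fin m → M) = u := hu
    have : x * y = g := Subtype.ext (by simpa using h)
    simpa [← this] using hy

/-- These sets, for finite `F ⊆ N`, cut out the stabilizer of `X`: some translate of the symmetric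
difference misses `F`. -/
theorem definable_exists_forall_mul {X : Set H} (hX : A.Definable L (Subtype.val '' X))
    {F : Finset H} (hF : ∀ n ∈ F, ∀ j, (n : Fin m → M) j ∈ A) :
    A.Definable L (Subtype.val '' {g : H | ∃ h : H, ∀ n ∈ F, (h * n ∈ X ↔ g * (h * n) ∈ X)}) := by
  have h1 : A.Definable L {v : Fin m ⊕ Fin m → M | (fun j => v (.inr j)) ∈ H} :=
    hH.carrier.preimage_map (definableMap_reindex _)
  have h2 : ∀ n : F, A.Definable L {v : Fin m ⊕ Fin m → M |
      mulTotal H (fun j => v (.inr j)) n ∈ Subtype.val '' X ↔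
        mulTotal H (fun j => v (.inl j)) (mulTotal H (fun j => v (.inr j)) n) ∈
          Subtype.val '' X} := by
    intro n
    have h3 := hH.definableMap_mul (γ := Fin m ⊕ Fin m) (definableMap_reindex Sum.inr)
      (definableMap_const (hF n n.2))
    exact definable_iff (hX.preimage_map h3)
      (hX.preimage_map (hH.definableMap_mul (definableMap_reindex Sum.inl) h3))
  refine definable_image_val hH.carrier
    (h1.inter (Set.definable_iInter_of_finite h2)).exists_of_finite fun x => ?_
  simp only [Set.mem_ofPred_eq, Set.mem_inter_iff, Sum.elim_inl, Sum.elim_inr, Set.mem_iInter]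
  constructor
  · rintro ⟨h, hh⟩
    refine ⟨h, h.2, fun n => ?_⟩
    simpa using hh n n.2
  · rintro ⟨h, hh, hh'⟩
    refine ⟨⟨h, hh⟩, fun n hn => ?_⟩
    have := hh' ⟨n, hn⟩
    rw [mulTotal_coe H ⟨h, hh⟩ n] at this
    simpa using this

/-- The parameters for which `k` translates of a member of a definable family cover `H`. -/
theorem definable_exists_cover {δ : Type*} [Finite δ] {X : Set (Fin m ⊕ δ → M)}
    (hX : A.Definable L X) (k : ℕ) :
    A.Definable L {y : δ → M | ∃ g : Fin k → H, ∀ h : H, ∃ i,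
      Sum.elim ((g i * h : H) : Fin m → M) y ∈ X} := by
  have h1 : A.Definable L {v : (δ ⊕ Fin k × Fin m) ⊕ Fin m → M | (fun j => v (.inr j)) ∈ H} :=
    hH.carrier.preimage_map (definableMap_reindex _)
  have h2 : ∀ i : Fin k, A.Definable L {v : (δ ⊕ Fin k × Fin m) ⊕ Fin m → M |
      Sum.elim (mulTotal H (fun j => v (.inl (.inr (i, j)))) (fun j => v (.inr j)))
        (fun j => v (.inl (.inl j))) ∈ X} := by
    intro i
    refine hX.preimage_map (F := fun v : (δ ⊕ Fin k × Fin m) ⊕ Fin m → M => Sum.elim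
      (mulTotal H (fun j => v (.inl (.inr (i, j)))) (fun j => v (.inr j)))
        (fun j => v (.inl (.inl j)))) ?_
    rintro (j | j)
    · exact hH.definableMap_mul (definableMap_reindex _) (definableMap_reindex _) j
    · exact Set.DefinableFun.proj L
  have h3 : ∀ i : Fin k, A.Definable L {v : δ ⊕ Fin k × Fin m → M |
      (fun j => v (.inr (i, j))) ∈ H} := fun i =>
    hH.carrier.preimage_map (definableMap_reindex _)
  refine (congrArg (A.Definable L) ?_).mp ((Set.definable_iInter_of_finite h3).inter
    (h1.compl.union (Set.definable_iUnion_of_finite h2)).forall_of_finite).exists_of_finite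
  ext y
  simp only [Set.mem_ofPred_eq, Set.mem_inter_iff, Set.mem_union, Set.mem_compl_iff,
    Sum.elim_inl, Sum.elim_inr, Set.mem_iInter, Set.mem_iUnion]
  constructor
  · rintro ⟨u, hu, hu'⟩
    refine ⟨fun i => ⟨_, hu i⟩, fun h => ?_⟩
    obtain ⟨i, hi⟩ := (hu' h).resolve_left (fun hh => hh h.2)
    refine ⟨i, ?_⟩
    rwa [← mulTotal_coe]
  · rintro ⟨g, hg⟩
    refine ⟨fun t => (g t.1 : Fin m → M) t.2, fun i => (g i).2, fun h => ?_⟩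
    by_cases hh : h ∈ H
    · obtain ⟨i, hi⟩ := hg ⟨h, hh⟩
      refine .inr ⟨i, ?_⟩
      rwa [← mulTotal_coe] at hi
    · exact .inl hh

end IsDefinableGroup

end Definability

/-! ### The fsg type of a definable group and absolute connectedness -/

section Generic

theorem image_val_eq_inter {M : Type w} {m : ℕ} {H : Set (Fin m → M)} (X : Set (Fin m → M)) :
    Subtype.val '' {x : H | (x : Fin m → M) ∈ X} = X ∩ H := by
  ext x
  simp [and_comm]

variable {L : FirstOrder.Language.{u, v}} {M : Type w} [L.Structure M] {A : Set M} {m : ℕ}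
  {H : Set (Fin m → M)} [Group H] {κ : Cardinal.{w}}

theorem isLeftGeneric_iff {X : Set (Fin m → M)} :
    IsLeftGeneric H X ↔ LeftGen {x : H | (x : Fin m → M) ∈ X} := by
  classical
  constructor
  · rintro ⟨F, hF⟩
    refine ⟨F.image (·⁻¹), fun h => ?_⟩
    obtain ⟨f, hf, x, hx, rfl⟩ := hF h
    exact ⟨f⁻¹, Finset.mem_image_of_mem _ hf, by simpa using hx⟩
  · rintro ⟨F, hF⟩
    refine ⟨F.image (·⁻¹), fun h => ?_⟩
    obtain ⟨f, hf, hx⟩ := hF h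
    exact ⟨f⁻¹, Finset.mem_image_of_mem _ hf, f * h, hx, by simp⟩

theorem IsMonster.union_lt (hM : IsMonster L M κ) {B C : Set M} (hB : #B < κ) (hC : #C < κ) :
    #(B ∪ C : Set M) < κ :=
  (mk_union_le B C).trans_lt (add_lt_of_lt hM.aleph0_lt.le hB hC)

theorem IsMonster.finite_lt (hM : IsMonster L M κ) {B : Set M} (hB : B.Finite) : #B < κ :=
  (Cardinal.lt_aleph0_iff_set_finite.2 hB).trans hM.aleph0_lt

omit [Group H] in
theorem IsMonster.mk_tuples_lt (hM : IsMonster L M κ) {B : Set M} (hB : #B < κ) :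
    #{x : H | ∀ j, (x : Fin m → M) j ∈ B} < κ := by
  let f : {x : H | ∀ j, (x : Fin m → M) j ∈ B} → (Fin m → B) := fun x j => ⟨_, x.2 j⟩
  have hf : Function.Injective f := fun x y h =>
    Subtype.ext (Subtype.ext (funext fun j => congrArg Subtype.val (congrFun h j)))
  refine (mk_le_of_injective hf).trans_lt ?_
  rw [mk_arrow, mk_fin, lift_natCast, lift_uzero, power_natCast]
  exact power_nat_le_max.trans_lt (max_lt hB hM.aleph0_lt)

theorem exists_finite_definable {X : Set (Fin m → M)}
    (hX : (Set.univ : Set M).Definable L X) : ∃ B : Set M, B.Finite ∧ B.Definable L X := by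
  obtain ⟨B, -, hB⟩ := Set.definable_iff_finitely_definable.1 hX
  exact ⟨B, B.finite_toSet, hB⟩

theorem IsMonster.exists_finset_of_forall (hM : IsMonster L M κ) (hA : #A < κ)
    (hH : IsDefinableGroup L H A) {N : Set M} (hN : #N < κ) {X : Set H}
    (hX : (Set.univ : Set M).Definable L (Subtype.val '' X))
    (h : ∀ h : H, ∃ n ∈ {x : H | ∀ j, (x : Fin m → M) j ∈ N}, h * n ∈ X) :
    ∃ F : Finset H, (F : Set H) ⊆ {x : H | ∀ j, (x : Fin m → M) j ∈ N} ∧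
      ∀ h : H, ∃ n ∈ F, h * n ∈ X := by
  classical
  by_contra! hcon
  obtain ⟨B, hBfin, hB⟩ := exists_finite_definable hX
  have hC : #(A ∪ N ∪ B : Set M) < κ := hM.union_lt (hM.union_lt hA hN) (hM.finite_lt hBfin)
  have hHC := hH.mono (B := A ∪ N ∪ B) (by intro; simp +contextual)
  let f : H → Set (Fin m → M) := fun n => Subtype.val '' {x : H | x * n ∈ Xᶜ}
  obtain ⟨a, ha⟩ := hM.saturated.exists_mem_of_fip hC
    (f '' {x : H | ∀ j, (x : Fin m → M) j ∈ N}) (by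
      rintro _ ⟨n, hn, rfl⟩
      exact hHC.definable_mul_right (hHC.definable_compl (hB.mono Set.subset_union_right))
        fun j => .inl (.inr (hn j))) (by
      intro F hF
      obtain ⟨F', hF', rfl⟩ := Finset.subset_set_image_iff.1 hF
      obtain ⟨a, ha⟩ := hcon F' hF'
      refine ⟨a, fun Y hY => ?_⟩
      obtain ⟨n, hn, rfl⟩ := Finset.mem_image.1 hY
      exact ⟨a, ha n hn, rfl⟩)
  -- The family is nonempty, and any member of it places the realization `a` in `H`.
  obtain ⟨n, hn, -⟩ := h 1
  obtain ⟨b, -, rfl⟩ := ha _ ⟨n, hn, rfl⟩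
  obtain ⟨n, hn, hb⟩ := h b
  obtain ⟨b', hb', e⟩ := ha _ ⟨n, hn, rfl⟩
  obtain rfl : b' = b := Subtype.ext e
  exact hb' hb

/-- The index is at most `2` to the number of `N`-points of `H`, which is below the strong limit
`κ`. Non-genericity of the symmetric difference is a conjunction of definable conditions, one for
each finite set of `N`-points. -/
theorem IsMonster.stabilizer_eq_top (hM : IsMonster L M κ) (hA : #A < κ)
    (hH : IsDefinableGroup L H A) (hconn : IsAbsolutelyConnected L H κ) {N : Set M} (hN : #N < κ)
    {Q : Set H → Prop} (hQ : IsFSGUltrafilter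
      (fun X : Set H => (Set.univ : Set M).Definable L (Subtype.val '' X)) Q
      {x : H | ∀ j, (x : Fin m → M) j ∈ N}) {X : Set H}
    (hX : (Set.univ : Set M).Definable L (Subtype.val '' X)) : hQ.stabilizer hX = ⊤ := by
  refine hconn _ ?_ ((hQ.mk_quotient_stabilizer_le hX).trans_lt
    (hM.strongLimit.isStrongPrelimit (hM.mk_tuples_lt hN)))
  obtain ⟨B, hBfin, hB⟩ := exists_finite_definable hX
  have hHC := hH.mono (B := A ∪ N ∪ B) (by intro; simp +contextual)
  have hXC := hB.mono (B := A ∪ N ∪ B) Set.subset_union_right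
  let E : Finset H → Set H := fun F => {g : H | ∃ h : H, ∀ n ∈ F, (h * n ∈ X ↔ g * (h * n) ∈ X)}
  have hE : ∀ F : Finset H, (F : Set H) ⊆ {x : H | ∀ j, (x : Fin m → M) j ∈ N} →
      (A ∪ N ∪ B).Definable L (Subtype.val '' E F) := fun F hF =>
    hHC.definable_exists_forall_mul hXC fun n hn j => .inl (.inr (hF hn j))
  have hmem : ∀ g, g ∈ hQ.stabilizer hX ↔
      ∀ F : Finset H, (F : Set H) ⊆ {x : H | ∀ j, (x : Fin m → M) j ∈ N} → g ∈ E F := by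
    intro g
    rw [hQ.mem_stabilizer_iff, hQ.leftGen_iff_exists_finset (hQ.symmDiff hX (hQ.shift hX g))]
    push Not
    refine forall₂_congr fun F hF => exists_congr fun h => forall₂_congr fun n hn => ?_
    simp only [Set.mem_symmDiff, Set.mem_ofPred_eq]
    tauto
  refine ⟨A ∪ N ∪ B, hM.union_lt (hM.union_lt hA hN) (hM.finite_lt hBfin),
    {φ | ∃ F : Finset H, (F : Set H) ⊆ {x : H | ∀ j, (x : Fin m → M) j ∈ N} ∧
      Subtype.val '' E F = {x | φ.Realize x}}, fun x => ?_⟩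
  constructor
  · rintro ⟨hx, hx'⟩ φ ⟨F, hF, e⟩
    exact e.subset ⟨_, (hmem _).1 hx' F hF, rfl⟩
  · intro h
    have key : ∀ F : Finset H, (F : Set H) ⊆ {x : H | ∀ j, (x : Fin m → M) j ∈ N} →
        x ∈ Subtype.val '' E F := by
      intro F hF
      obtain ⟨φ, e⟩ := hE F hF
      exact e.symm.subset (h φ ⟨F, hF, e⟩)
    -- The condition for `F = ∅` only says that `x` lies in `H`.
    obtain ⟨y, -, rfl⟩ := key ∅ (by simp)
    refine ⟨y.2, (hmem _).2 fun F hF => ?_⟩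
    obtain ⟨z, hz, e⟩ := key F hF
    obtain rfl := Subtype.ext e
    exact hz

variable [Nonempty M] {p : GlobalType L M (Fin m)}

theorem IsMonster.isFSGUltrafilter (hM : IsMonster L M κ) (hA : #A < κ)
    (hH : IsDefinableGroup L H A) (hp : p.Contains H) {N : Set M} (hN : #N < κ)
    (hfs : ∀ g : H, FinitelySatisfiableIn (translate L H g p) N) :
    IsFSGUltrafilter (fun X : Set H => (Set.univ : Set M).Definable L (Subtype.val '' X))
      (fun X => p.Contains (Subtype.val '' X)) {x : H | ∀ j, (x : Fin m → M) j ∈ N} where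
  compl hX := (hH.mono (Set.subset_univ _)).definable_compl hX
  inter hX hY := by
    rw [Set.image_inter Subtype.val_injective]
    exact hX.inter hY
  shift hX g := (hH.mono (Set.subset_univ _)).definable_mul_left hX fun _ => trivial
  inv hX := by
    simpa using (hH.mono (Set.subset_univ _)).definable_inv_mul hX (g := 1) fun _ => trivial
  mem_or {X} hX := by
    refine (p.contains_or_compl hX).imp_right fun h => ?_
    refine (h.inter hp).mono ((hH.mono (Set.subset_univ _)).definable_compl hX) ?_
    rintro x ⟨hx, hx'⟩
    exact ⟨⟨x, hx'⟩, fun h => hx ⟨_, h, rfl⟩, rfl⟩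
  mem_inter hX hY := by
    rw [Set.image_inter Subtype.val_injective]
    exact hX.inter hY
  mem_nonempty h := Set.image_nonempty.1 h.nonempty
  mem_mono h hY hXY := h.mono hY (Set.image_mono hXY)
  exists_mem {X} hX g h := by
    obtain ⟨φ, hφ⟩ := definable_univ_iff.1 hX
    have hφ' : φ ∈ translate L H g p := by
      refine (congrArg p.Contains ?_).mp h
      ext x
      constructor
      · rintro ⟨x, hx, rfl⟩
        exact ⟨x.2, hφ.symm.subset ⟨_, hx, rfl⟩⟩
      · rintro ⟨hx, hx'⟩
        obtain ⟨y, hy, e⟩ := hφ.subset hx'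
        obtain rfl := Subtype.ext e
        exact ⟨⟨x, hx⟩, hy, rfl⟩
    obtain ⟨a, haN, ha⟩ := hfs g {φ} (by simpa using hφ')
    obtain ⟨y, hy, rfl⟩ := hφ.subset (ha φ (by simp))
    exact ⟨y, haN, hy⟩
  compact hX h := hM.exists_finset_of_forall hA hH hN hX h

end Generic

/-! ### Morley sequences of a definable type -/

section Morley

variable {L : FirstOrder.Language.{u, v}} {M : Type w} [L.Structure M] {A : Set M} {m : ℕ}
  {κ : Cardinal.{w}} {p : GlobalType L M (Fin m)}

theorem finite_setOf_coordinates {n : ℕ} (a : Fin n → Fin m → M) :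
    {b | ∃ j t, b = a j t}.Finite := by
  have : {b | ∃ j t, b = a j t} = Set.range fun t : Fin n × Fin m => a t.1 t.2 := by
    ext b; simp [eq_comm]
  rw [this]
  exact Set.finite_range _

variable [Nonempty M]

theorem RealizesOver.mono {B C : Set M} {a : Fin m → M} (h : RealizesOver p.formulas C a)
    (hBC : B ⊆ C) : RealizesOver p.formulas B a :=
  GlobalType.realizesOver_iff.2 fun X hX =>
    GlobalType.realizesOver_iff.1 h X (hX.mono hBC)

namespace GlobalType

theorem IsMorleySequence.castSucc {n : ℕ} {a : Fin (n + 1) → Fin m → M}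
    (h : p.IsMorleySequence A a) : p.IsMorleySequence A fun i => a i.castSucc := by
  intro i
  refine (h i.castSucc).mono (Set.union_subset_union_right _ ?_)
  rintro b ⟨j, hj, t, rfl⟩
  exact ⟨j.castSucc, by simpa using hj, t, rfl⟩

theorem IsMorleySequence.snoc {n : ℕ} {a : Fin n → Fin m → M} {b : Fin m → M}
    (h : p.IsMorleySequence A a) (hb : RealizesOver p.formulas (A ∪ {b | ∃ j t, b = a j t}) b) :
    p.IsMorleySequence (n := n + 1) A (Fin.snoc a b : Fin (n + 1) → Fin m → M) := by
  intro i
  induction i using Fin.lastCases with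
  | last =>
    rw [Fin.snoc_last]
    refine hb.mono (Set.union_subset_union_right _ ?_)
    rintro c ⟨j, hj, t, rfl⟩
    induction j using Fin.lastCases with
    | last => exact (lt_irrefl _ hj).elim
    | cast j => exact ⟨j, t, by rw [Fin.snoc_castSucc]⟩
  | cast i =>
    rw [Fin.snoc_castSucc]
    refine (h i).mono (Set.union_subset_union_right _ ?_)
    rintro c ⟨j, hj, t, rfl⟩
    induction j using Fin.lastCases with
    | last => exact (not_lt_of_ge (Fin.le_last _) hj).elim
    | cast j => exact ⟨j, by simpa using hj, t, by rw [Fin.snoc_castSucc]⟩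

theorem exists_isMorleySequence (hM : IsMonster L M κ) (p : GlobalType L M (Fin m)) {C : Set M}
    (hC : #C < κ) (n : ℕ) : ∃ a : Fin n → Fin m → M, p.IsMorleySequence C a := by
  induction n with
  | zero => exact ⟨fun i => i.elim0, fun i => i.elim0⟩
  | succ n ih =>
    obtain ⟨a, ha⟩ := ih
    obtain ⟨b, hb⟩ := hM.saturated.exists_realizesOver p
      (hM.union_lt hC (hM.finite_lt (finite_setOf_coordinates a)))
    exact ⟨_, ha.snoc hb⟩

/-- If `p` is definable over `A`, then its Morley sequences over `A` of a given length have the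
same type over `A`. -/
theorem IsMorleySequence.mem_iff
    (hdef : ∀ {n : ℕ} {X : Set (Fin m ⊕ Fin n × Fin m → M)}, A.Definable L X →
      A.Definable L {y | p.Contains {x | Sum.elim x y ∈ X}}) {n : ℕ} {a b : Fin n → Fin m → M}
    (ha : p.IsMorleySequence A a) (hb : p.IsMorleySequence A b) {X : Set (Fin n × Fin m → M)}
    (hX : A.Definable L X) :
    (fun t : Fin n × Fin m => a t.1 t.2) ∈ X ↔ (fun t : Fin n × Fin m => b t.1 t.2) ∈ X := by
  induction n with
  | zero =>
    have : a = b := funext fun i => i.elim0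
    rw [this]
  | succ n ih =>
    -- The last tuple is split off; the `p`-definition of `X` then replaces a condition on all `n +
    -- 1` tuples by one on the first `n`.
    let e : Fin (n + 1) × Fin m → Fin m ⊕ Fin n × Fin m := fun t =>
      Fin.lastCases (motive := fun _ => Fin m ⊕ Fin n × Fin m) (.inl t.2) (fun i => .inr (i, t.2))
        t.1
    let Y : Set (Fin m ⊕ Fin n × Fin m → M) := (fun g => g ∘ e) ⁻¹' X
    have hY : A.Definable L Y := hX.preimage_comp e
    have key : ∀ c : Fin (n + 1) → Fin m → M, p.IsMorleySequence A c →
        ((fun t : Fin (n + 1) × Fin m => c t.1 t.2) ∈ X ↔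
          (fun t : Fin n × Fin m => c t.1.castSucc t.2) ∈
            {y | p.Contains {x | Sum.elim x y ∈ Y}}) := by
      intro c hc
      have h1 : (fun t : Fin (n + 1) × Fin m => c t.1 t.2) =
          Sum.elim (c (Fin.last n)) (fun t : Fin n × Fin m => c t.1.castSucc t.2) ∘ e := by
        ext ⟨i, t⟩
        induction i using Fin.lastCases with
        | last => simp [e]
        | cast i => simp [e]
      rw [h1]
      refine (hc (Fin.last n)).mem_iff
        (X := {x | Sum.elim x (fun t : Fin n × Fin m => c t.1.castSucc t.2) ∈ Y}) ?_
      exact definable_fiber (hY.mono Set.subset_union_left) fun t =>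
        .inr ⟨t.1.castSucc, Fin.castSucc_lt_last _, t.2, rfl⟩
    rw [key a ha, key b hb]
    exact ih ha.castSucc hb.castSucc (hdef hY)

/-- A formula over `A` in the power holds of a Morley sequence over some `A ∪ B`; that sequence is
also Morley over `A`, so it has the same type over `A` as `a`. -/
theorem IsMorleySequence.realizesOver_power (hM : IsMonster L M κ) (hA : #A < κ)
    (hdef : ∀ {n : ℕ} {X : Set (Fin m ⊕ Fin n × Fin m → M)}, A.Definable L X →
      A.Definable L {y | p.Contains {x | Sum.elim x y ∈ X}}) {n : ℕ} {a : Fin n → Fin m → M}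
    (ha : p.IsMorleySequence A a) :
    RealizesOver (p.power A n) A (fun t => a t.1 t.2) := by
  rintro φ ⟨B, hB, h⟩
  obtain ⟨b, hb⟩ := p.exists_isMorleySequence hM (hM.union_lt hA (hM.finite_lt hB)) n
  have hbφ := h b hb
  rw [LHom.realize_onFormula] at hbφ
  have hbA : p.IsMorleySequence A b := fun i =>
    (hb i).mono (Set.union_subset_union_left _ Set.subset_union_left)
  exact (ha.mem_iff hdef hbA (X := {x | φ.Realize x}) ⟨φ, rfl⟩).2 hbφ

end GlobalType

end Morley

/-! ### Definability of the generic type and products of two realizations -/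

section Main

variable {L : FirstOrder.Language.{u, v}} {M : Type w} [L.Structure M] [Nonempty M] {A : Set M}
  {m : ℕ} {H : Set (Fin m → M)} [Group H] {κ : Cardinal.{w}} {p : GlobalType L M (Fin m)}

/-- A type whose formulas are those whose trace on `H` is generic is definable over the set over
which `H` is. -/
theorem IsMonster.definable_contains (hM : IsMonster L M κ) (hA : #A < κ)
    (hH : IsDefinableGroup L H A)
    (hgen : ∀ X, (Set.univ : Set M).Definable L X →
      (p.Contains X ↔ LeftGen {x : H | (x : Fin m → M) ∈ X}))
    {δ : Type*} [Finite δ] {X : Set (Fin m ⊕ δ → M)} (hX : A.Definable L X) :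
    A.Definable L {y | p.Contains {x | Sum.elim x y ∈ X}} := by
  classical
  let U : Set (Fin m ⊕ δ → M) → ℕ → Set (δ → M) := fun Y k =>
    {y : δ → M | ∃ g : Fin k → H, ∀ h : H, ∃ i, Sum.elim ((g i * h : H) : Fin m → M) y ∈ Y}
  have hU : ∀ Y k, A.Definable L Y → A.Definable L (U Y k) := fun Y k hY =>
    hH.definable_exists_cover hY k
  have hfib : ∀ (Y : Set (Fin m ⊕ δ → M)) (y : δ → M), A.Definable L Y →
      (Set.univ : Set M).Definable L {x : Fin m → M | Sum.elim x y ∈ Y} := fun Y y hY =>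
    definable_fiber (hY.mono (Set.subset_univ _)) fun _ => trivial
  have hUC : ∀ Y y, A.Definable L Y →
      (p.Contains {x | Sum.elim x y ∈ Y} ↔ ∃ k, y ∈ U Y k) := by
    intro Y y hY
    rw [hgen _ (hfib Y y hY)]
    constructor
    · rintro ⟨F, hF⟩
      refine ⟨F.card, fun i => F.equivFin.symm i, fun h => ?_⟩
      obtain ⟨f, hf, hx⟩ := hF h
      exact ⟨F.equivFin ⟨f, hf⟩, by simpa using hx⟩
    · rintro ⟨k, g, hg⟩
      refine ⟨Finset.univ.image g, fun h => ?_⟩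
      obtain ⟨i, hi⟩ := hg h
      exact ⟨g i, Finset.mem_image_of_mem _ (Finset.mem_univ _), hi⟩
  -- For each `y` the fiber or its complement is in `p`, hence generic, so the sets `U X k ∪ U Xᶜ k`
  -- cover all `y`; saturation leaves finitely many `k`.
  obtain ⟨K, hK⟩ : ∃ K : Finset ℕ, ∀ y, ∃ k ∈ K, y ∈ U X k ∨ y ∈ U Xᶜ k := by
    by_contra! hcon
    obtain ⟨y, hy⟩ := hM.saturated.exists_mem_of_fip hA
      (Set.range fun k => (U X k ∪ U Xᶜ k)ᶜ) (by
        rintro _ ⟨k, rfl⟩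
        exact ((hU X k hX).union (hU Xᶜ k hX.compl)).compl) (by
        intro F hF
        rw [← Set.image_univ] at hF
        obtain ⟨K, -, rfl⟩ := Finset.subset_set_image_iff.1 hF
        obtain ⟨y, hy⟩ := hcon K
        refine ⟨y, fun Y hY => ?_⟩
        obtain ⟨k, hk, rfl⟩ := Finset.mem_image.1 hY
        have := hy k hk
        simpa using this)
    rcases p.contains_or_compl (hfib X y hX) with h | h
    · obtain ⟨k, hk⟩ := (hUC X y hX).1 h
      exact hy _ ⟨k, rfl⟩ (.inl hk)
    · obtain ⟨k, hk⟩ := (hUC Xᶜ y hX.compl).1 h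
      exact hy _ ⟨k, rfl⟩ (.inr hk)
  refine (congrArg (A.Definable L) ?_).mp
    (Set.definable_biUnion_finset (fun k => hU X k hX) K)
  ext y
  simp only [Set.mem_iUnion, Set.mem_ofPred_eq, exists_prop]
  refine ⟨fun ⟨k, _, hk⟩ => (hUC X y hX).2 ⟨k, hk⟩, fun h => ?_⟩
  obtain ⟨k, hkK, hk⟩ := hK y
  -- Otherwise both the fiber and its complement would be in `p`.
  refine ⟨k, hkK, hk.resolve_right fun hk => ?_⟩
  obtain ⟨x, hx, hx'⟩ := (h.inter ((hUC Xᶜ y hX.compl).2 ⟨k, hk⟩)).nonempty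
  exact hx' hx

omit [Nonempty M] in
theorem isInvariantOver_of_definable
    (hdef : ∀ {k : ℕ} {X : Set (Fin m ⊕ Fin k → M)}, A.Definable L X →
      A.Definable L {y | p.Contains {x | Sum.elim x y ∈ X}}) : p.IsInvariantOver A := by
  intro k φ c c' hcc
  have hφ : A.Definable L {v : Fin m ⊕ Fin k → M | φ.Realize v} :=
    (Set.empty_definable_iff.2 ⟨φ, rfl⟩).mono (Set.empty_subset A)
  obtain ⟨ψ, hψ⟩ := hdef hφ
  have h : ∀ y : Fin k → M, p.Contains {x | φ.Realize (Sum.elim x y)} ↔ ψ.Realize y := fun y =>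
    ⟨fun h => hψ.subset h, fun h => hψ.symm.subset h⟩
  rw [h c, h c']
  exact hcc ψ

/-- Every element of the group is a product of two realizations of a generic type. -/
theorem IsMonster.exists_mul_eq (hM : IsMonster L M κ) (hH : IsDefinableGroup L H A)
    (hp : p.Contains H)
    (hinv : ∀ (X : Set H) (a : H), p.Contains (Subtype.val '' X) →
      p.Contains (Subtype.val '' {x : H | x⁻¹ * a ∈ X}))
    {C : Set M} (hAC : A ⊆ C) (hC : #C < κ) (x : H) :
    ∃ a b : H, a * b = x ∧ RealizesOver p.formulas C (a : Fin m → M) ∧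
      RealizesOver p.formulas C (b : Fin m → M) := by
  have hD : #(C ∪ Set.range (x : Fin m → M) : Set M) < κ :=
    hM.union_lt hC (hM.finite_lt (Set.finite_range _))
  have hHD := hH.mono (hAC.trans (Set.subset_union_left (t := Set.range (x : Fin m → M))))
  -- With `a` realizing `p` over `C` and the coordinates of `x`, the invariance `hinv` shows that
  -- `a⁻¹ * x` realizes `p` over `C`.
  obtain ⟨a, ha⟩ := hM.saturated.exists_realizesOver p hD
  have haH : a ∈ H := GlobalType.realizesOver_iff.1 ha H hHD.carrier hp
  refine ⟨⟨a, haH⟩, ⟨a, haH⟩⁻¹ * x, by simp, ha.mono Set.subset_union_left,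
    GlobalType.realizesOver_iff.2 fun X hX hpX => ?_⟩
  have hX' : C.Definable L (Subtype.val '' {x : H | (x : Fin m → M) ∈ X}) := by
    rw [image_val_eq_inter]
    exact hX.inter (hH.mono hAC).carrier
  have h1 := hinv {x : H | (x : Fin m → M) ∈ X} x (by
    rw [image_val_eq_inter]
    exact hpX.inter hp)
  obtain ⟨y, hy, e⟩ := GlobalType.realizesOver_iff.1 ha _
    (hHD.definable_inv_mul (hX'.mono Set.subset_union_left) fun j => .inr ⟨j, rfl⟩) h1
  obtain rfl : y = ⟨a, haH⟩ := Subtype.ext e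
  exact hy

end Main

end MonsterGroup

/-- The index is shifted: `(⊤ : Subgroup H).lowerCentralSeries n` is the term `Γ_{n+1}(H)`, with
`Γ_1(H) = H`, and `iteratedCommutator n` is `γ_{n+1}`. -/
theorem mainTheorem5 {L : FirstOrder.Language.{u, v}} {M : Type w} [L.Structure M] [Nonempty M]
    (κ : Cardinal.{w}) (hM : MonsterGroup.IsMonster L M κ)
    (A : Set M) (hA : #A < κ)
    {m : ℕ} (H : Set (Fin m → M)) [Group H] (hH : MonsterGroup.IsDefinableGroup L H A)
    (hconn : MonsterGroup.IsAbsolutelyConnected L H κ)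
    (hfsg : MonsterGroup.HasFSG L H κ) :
    ∃ p : MonsterGroup.GlobalType L M (Fin m),
      MonsterGroup.IsGenericType L H p ∧
      (∀ q : MonsterGroup.GlobalType L M (Fin m), MonsterGroup.IsGenericType L H q → q = p) ∧
      p.IsInvariantOver A ∧
      ∀ (n : ℕ), ∀ x ∈ (⊤ : Subgroup H).lowerCentralSeries n,
        ∃ l : List H, l.prod = x ∧
          ∀ y ∈ l, ∃ (c : H) (g : Fin (n + 1) → H),
            MonsterGroup.RealizesOver (p.power A (n + 1)) A
              (fun t => (g t.1 : Fin m → M) t.2) ∧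
            y = c⁻¹ * MonsterGroup.iteratedCommutator n g * c := by
  open MonsterGroup in
  obtain ⟨p, hp, N, hN, hfs⟩ := hfsg
  have hQ := hM.isFSGUltrafilter hA hH hp hN hfs
  have hHuniv := hH.mono (Set.subset_univ A)
  have hmem : ∀ {X : Set H}, (Set.univ : Set M).Definable L (Subtype.val '' X) →
      (p.Contains (Subtype.val '' X) ↔ LeftGen X) := fun hX =>
    hQ.mem_iff_leftGen (fun hX => hM.stabilizer_eq_top hA hH hconn hN hQ hX) hX
  have hgen : ∀ X, (Set.univ : Set M).Definable L X →
      (p.Contains X ↔ LeftGen {x : H | (x : Fin m → M) ∈ X}) := by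
    intro X hX
    have hXH : (Set.univ : Set M).Definable L
        (Subtype.val '' {x : H | (x : Fin m → M) ∈ X}) := by
      rw [image_val_eq_inter]
      exact hX.inter hHuniv.carrier
    rw [← hmem hXH, image_val_eq_inter]
    exact ⟨fun h => h.inter hp, fun h => h.mono hX Set.inter_subset_left⟩
  have hinv : ∀ (X : Set H) (a : H), p.Contains (Subtype.val '' X) →
      p.Contains (Subtype.val '' {x : H | x⁻¹ * a ∈ X}) := by
    intro X a hX
    rw [hmem (hHuniv.definable_inv_mul hX.definable fun _ => trivial)]
    exact (hQ.rightGen_of_leftGen hX.definable ((hmem hX.definable).1 hX)).leftGen_inv_mul a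
  refine ⟨p, ⟨hp, fun φ hφ => ?_⟩, fun q hq => ?_, ?_, fun n x hx => ?_⟩
  · have h := p.mem_formulas_iff_contains.1 hφ
    exact isLeftGeneric_iff.2 ((hgen _ h.definable).1 h)
  -- Every set in a generic type `q` is generic, hence in `p`; complete types that are included in
  -- one another are equal.
  · refine GlobalType.ext_of_contains fun X hX => (hgen X hX.definable).2 ?_
    obtain ⟨φ, hφ, rfl⟩ := hX
    exact isLeftGeneric_iff.1 (hq.2 φ hφ)
  · exact isInvariantOver_of_definable (hM.definable_contains hA hH hgen)
  · have h := mem_closure_conj_iteratedCommutator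
      (fun n => {g : Fin (n + 1) → H | p.IsMorleySequence A fun i => (g i : Fin m → M)})
      (fun x => ?_) (fun n g hg x => ?_) n x hx
    · obtain ⟨l, hl, rfl⟩ := Submonoid.exists_list_of_mem_closure h
      refine ⟨l, rfl, fun y hy => ?_⟩
      obtain ⟨c, g, hg, e⟩ := hl y hy
      exact ⟨c, g, GlobalType.IsMorleySequence.realizesOver_power hM hA
        (hM.definable_contains hA hH hgen) hg, e⟩
    · obtain ⟨a, b, hab, ha, hb⟩ := hM.exists_mul_eq hH hp hinv subset_rfl hA x
      refine ⟨a, b, hab, fun i => ha.mono ?_, fun i => hb.mono ?_⟩ <;>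
      · rintro c (hc | ⟨j, hj, -⟩)
        · exact hc
        · exact (hj.ne (Subsingleton.elim (α := Fin 1) _ _)).elim
    -- Both factors realize `p` over `A` and the coordinates of `g`, so each of them extends the
    -- Morley sequence `g`.
    · obtain ⟨a, b, hab, ha, hb⟩ := hM.exists_mul_eq hH hp hinv Set.subset_union_left
        (hM.union_lt hA (hM.finite_lt
          (finite_setOf_coordinates fun i => (g i : Fin m → M)))) x
      have hsnoc : ∀ c : H, (fun i => ((Fin.snoc g c : Fin (n + 1 + 1) → H) i : Fin m → M)) =
          (Fin.snoc (fun i => (g i : Fin m → M)) (c : Fin m → M) :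
            Fin (n + 1 + 1) → Fin m → M) := by
        intro c
        ext i : 1
        induction i using Fin.lastCases with
        | last => simp
        | cast i => simp
      refine ⟨a, b, hab, ?_, ?_⟩
      · rw [Set.mem_ofPred_eq, hsnoc]
        exact hg.snoc ha
      · rw [Set.mem_ofPred_eq, hsnoc]
        exact hg.snoc hb
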